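/- Let $n,p$ be natural numbers. For a symmetric positive definite $np\times np$ matrix $\mathbf\Omega$ let $\boldsymbol\omega=\mathrm{diag}(\sqrt{\omega_{11}},\dots,\sqrt{\omega_{np,np}})$ be the diagonal matrix of the square roots of its diagonal entries and $\overline{\mathbf\Omega}=\boldsymbol\omega^{-1}\mathbf\Omega\boldsymbol\omega^{-1}$ the associated correlation matrix. A random $n\times p$ matrix $\boldsymbol Z$ is skew-normal with location $\mathbf M\in\mathbb R^{n\times p}$, scale $\mathbf\Omega$ and skewness matrix $\mathbf B\in\mathbb R^{n\times p}$ if it has the density $$f(\mathbf Z)=2\,\phi_{np}\bigl(\mathrm{vec}(\mathbf Z);\mathrm{vec}(\mathbf M),\mathbf\Omega\bigr)\,\Phi\bigl(\mathrm{vec}(\mathbf B)^T\boldsymbol\omega^{-1}\mathrm{vec}(\mathbf Z-\mathbf M)\bigr),\qquad \mathbf Z\in\mathbb R^{n\times p},$$ with respect to Lebesgue measure, where $\phi_{np}(\cdot;\boldsymbol\mu,\mathbf\Omega)$ is the density of the normal distribution on $\mathbb R^{np}$ with mean $\boldsymbol\mu$ and covariance $\mathbf\Omega$, and $\Phi$ is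 the univariate standard normal distribution function. We write $\boldsymbol Z\sim SN_{n\times p}(\mathbf M,\mathbf\Omega,\mathbf B,\boldsymbol\delta)$, where $$\boldsymbol\delta=\bigl(1+\mathrm{vec}(\mathbf B)^T\overline{\mathbf\Omega}\,\mathrm{vec}(\mathbf B)\bigr)^{-1/2}\boldsymbol\omega\,\overline{\mathbf\Omega}\,\mathrm{vec}(\mathbf B)\in\mathbb R^{np},$$ and we write $*$ in place of $\mathbf B$ when $\mathbf B$ is an arbitrary matrix with this $\boldsymbol\delta$. For random $n\times p$ matrices, $\boldsymbol X\le_{cx}\boldsymbol Y$ means that $Ef(\boldsymbol X)\le Ef(\boldsymbol Y)$ for every convex $f:\mathbb R^{n\times p}\to\mathbb R$ for which both expectations are well defined (possibly infinite). Let $\mathbf V,\mathbf V'\in\mathbb R^{p\times p}$ and $\boldsymbol\Sigma,\boldsymbol\Sigma'\in\mathbb R^{n\times n}$ be symmetric positive definite, and let $\mathbf\Omega=\mathbf V\otimes\boldsymbol\Sigma$ and $\mathbf\Omega'=\mathbf V'\otimes\boldsymbol\Sigma'$. 1. Let $\boldsymbol X\sim SN_{n\times p}(\mathbf M,\mathbf\Omega,\mathbf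 B,\boldsymbol\delta)$ and $\boldsymbol Y\sim SN_{n\times p}(\mathbf M',\mathbf\Omega',\mathbf B',\boldsymbol\delta')$. If $\mathbf M=\mathbf M'$, $\boldsymbol\delta=\boldsymbol\delta'$ and $\mathbf\Omega'-\mathbf\Omega$ is positive semidefinite, then $\boldsymbol X\le_{cx}\boldsymbol Y$. 2. Let $\boldsymbol X_0\sim SN_{n\times p}(\mathbf 0,\overline{\mathbf\Omega},*,\boldsymbol\delta)$ and $\boldsymbol Y_0\sim SN_{n\times p}(\mathbf 0,\overline{\mathbf\Omega'},*,\boldsymbol\delta')$, where $\boldsymbol\delta,\boldsymbol\delta'$ are the vectors belonging to $\boldsymbol X_0$ and $\boldsymbol Y_0$ themselves. Then $\boldsymbol X_0\le_{cx}\boldsymbol Y_0$ if and only if $\boldsymbol\delta=\boldsymbol\delta'$ and $\overline{\mathbf\Omega'}-\overline{\mathbf\Omega}$ is positive semidefinite. -/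

import Mathlib

open MeasureTheory ProbabilityTheory
open scoped Matrix Kronecker ENNReal

namespace MatrixSkewNormal

/-- The space of real `m × n` matrices carries the product σ-algebra and the product of
one-dimensional Lebesgue measures (Lebesgue measure in the entries). -/
noncomputable instance instMeasureSpaceMatrix {m n : Type*} [Fintype m] [Fintype n] :
    MeasureSpace (Matrix m n ℝ) :=
  inferInstanceAs (MeasureSpace (m → n → ℝ))

section Parameters

variable {ι : Type*} [Fintype ι] [DecidableEq ι]

/-- `ω = diag(√Ω₁₁, …, √Ω_dd)`. -/
noncomputable def scaleDiag (Ω : Matrix ι ι ℝ) : Matrix ι ι ℝ :=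
  Matrix.diagonal fun i => √(Ω i i)

/-- The correlation matrix `Ω̄ = ω⁻¹ Ω ω⁻¹` associated with `Ω`. -/
noncomputable def corr (Ω : Matrix ι ι ℝ) : Matrix ι ι ℝ :=
  (scaleDiag Ω)⁻¹ * Ω * (scaleDiag Ω)⁻¹

/-- The density at `z` of the normal distribution with mean vector `μ` and covariance matrix `Ω`
(used for positive definite `Ω`). -/
noncomputable def normalDensity (μ : ι → ℝ) (Ω : Matrix ι ι ℝ) (z : ι → ℝ) : ℝ :=
  (√((2 * Real.pi) ^ Fintype.card ι * Ω.det))⁻¹ *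
    Real.exp (-(1 / 2) * ((z - μ) ⬝ᵥ (Ω⁻¹ *ᵥ (z - μ))))

/-- The distribution function `Φ` of the univariate standard normal distribution. -/
noncomputable def stdNormalCDF (x : ℝ) : ℝ := cdf (gaussianReal 0 1) x

/-- The parameter `δ = (1 + αᵀ Ω̄ α)^(-1/2) ω Ω̄ α`. -/
noncomputable def deltaParam (Ω : Matrix ι ι ℝ) (α : ι → ℝ) : ι → ℝ :=
  (√(1 + α ⬝ᵥ (corr Ω *ᵥ α)))⁻¹ • ((scaleDiag Ω * corr Ω) *ᵥ α)

end Parameters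

section MatrixVariate

variable {n p : ℕ}

/-- The density of the `n × p` matrix variate skew-normal distribution with location `M`, scale `Ω`
(an `np × np` matrix, indexed compatibly with `Matrix.vec`) and skewness matrix `B`:
`2 φ(vec Y; vec M, Ω) Φ(vec(B)ᵀ ω⁻¹ vec(Y - M))`. -/
noncomputable def density (M : Matrix (Fin n) (Fin p) ℝ)
    (Ω : Matrix (Fin p × Fin n) (Fin p × Fin n) ℝ) (B Y : Matrix (Fin n) (Fin p) ℝ) : ℝ :=
  2 * normalDensity M.vec Ω Y.vec *
    stdNormalCDF (B.vec ⬝ᵥ ((scaleDiag Ω)⁻¹ *ᵥ (Y - M).vec))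

/-- The matrix variate skew-normal distribution, as a measure. -/
noncomputable def law (M : Matrix (Fin n) (Fin p) ℝ)
    (Ω : Matrix (Fin p × Fin n) (Fin p × Fin n) ℝ) (B : Matrix (Fin n) (Fin p) ℝ) :
    Measure (Matrix (Fin n) (Fin p) ℝ) :=
  volume.withDensity fun Y => ENNReal.ofReal (density M Ω B Y)

/-- `X ∼ SN_{n×p}(M, Ω, B, δ)`: the random matrix `X` has the skew-normal distribution with
location `M`, scale `Ω` and skewness matrix `B`, and `δ` is the vector determined by `Ω`, `B`. -/
structure IsSkewNormal {S : Type*} [MeasurableSpace S] (P : Measure S)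
    (X : S → Matrix (Fin n) (Fin p) ℝ) (M : Matrix (Fin n) (Fin p) ℝ)
    (Ω : Matrix (Fin p × Fin n) (Fin p × Fin n) ℝ) (B : Matrix (Fin n) (Fin p) ℝ)
    (δ : Fin p × Fin n → ℝ) : Prop where
  hasLaw : HasLaw X (law M Ω B) P
  delta_eq : δ = deltaParam Ω B.vec

end MatrixVariate

section Orders

variable {S S' E : Type*} [MeasurableSpace S] [MeasurableSpace S']

/-- `E[g⁺]` and `E[g⁻]` are not both infinite, so that `E[g] = E[g⁺] - E[g⁻]` is well defined
in `[-∞, ∞]`. -/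
def ExpectationWellDefined (P : Measure S) (g : S → ℝ) : Prop :=
  ∫⁻ s, ENNReal.ofReal (g s) ∂P ≠ ∞ ∨ ∫⁻ s, ENNReal.ofReal (-g s) ∂P ≠ ∞

/-- The extended expectation `E[g] = E[g⁺] - E[g⁻]`; it equals the Bochner integral when `g` is
integrable. -/
noncomputable def extExpectation (P : Measure S) (g : S → ℝ) : EReal :=
  ((∫⁻ s, ENNReal.ofReal (g s) ∂P : ℝ≥0∞) : EReal) -
    ((∫⁻ s, ENNReal.ofReal (-g s) ∂P : ℝ≥0∞) : EReal)

/-- The integral stochastic order `X ≤_F Y`: `E f(X) ≤ E f(Y)` for all `f ∈ F`, whenever the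
expectations are well defined. -/
def IntegralOrder (F : Set (E → ℝ)) (P : Measure S) (X : S → E) (P' : Measure S') (Y : S' → E) :
    Prop :=
  ∀ f ∈ F, ExpectationWellDefined P (fun s => f (X s)) →
    ExpectationWellDefined P' (fun s => f (Y s)) →
      extExpectation P (fun s => f (X s)) ≤ extExpectation P' (fun s => f (Y s))

/-- The convex order `X ≤_cx Y` of random matrices: the integral order generated by the
(measurable) convex functions. -/
def ConvexOrder {n p : ℕ} (P : Measure S) (X : S → Matrix (Fin n) (Fin p) ℝ)
    (P' : Measure S') (Y : S' → Matrix (Fin n) (Fin p) ℝ) : Prop :=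
  IntegralOrder {f : Matrix (Fin n) (Fin p) ℝ → ℝ | Measurable f ∧ ConvexOn ℝ Set.univ f} P X P' Y

end Orders

end MatrixSkewNormal

/-! After vectorization, the skew-normal law is that of `m + |U| δ + R`, where `U` is standard
normal and `R` is an independent centred Gaussian vector with covariance `Ω - δ δᵀ`
(`skewPi_eq_map`). With `δ` fixed, enlarging `Ω` to `Ω'` only enlarges the covariance of `R`, so `Y`
has the law of `X` plus independent centred Gaussian noise with covariance `Ω' - Ω`
(`skewPi_eq_map_add`). The noise is symmetric, and averaging `2 g(x) ≤ g(x + w) + g(x - w)` shows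
that it raises expectations of convex functions (`extExpectation_le_of_symmetric_noise`).

Conversely, for location zero, linear test functions compare the means, which are a fixed positive
multiple of `δ`; using both `a` and `-a` forces `δ = δ'`. The convex functions `(a ⬝ᵥ x) ^ 2` then
compare second moments, whose difference is a positive multiple of `aᵀ (Ω' - Ω) a`
(`delta_eq_and_posSemidef_of_integralOrder`).

The Kronecker structure is used only to make the scale matrices positive definite. -/

namespace MatrixSkewNormal

/-! ### Gaussian vectors: characteristic functions and densities. -/

section GaussianVectors

open scoped MatrixOrder

lemma measurable_mulVec {ι : Type*} [Fintype ι] (A : Matrix ι ι ℝ) :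
    Measurable fun x : ι → ℝ => A *ᵥ x :=
  (A.mulVecLin.continuous_of_finiteDimensional).measurable

lemma measurable_dotProduct_left {ι : Type*} [Fintype ι] (a : ι → ℝ) :
    Measurable fun x : ι → ℝ => a ⬝ᵥ x := by
  unfold dotProduct; fun_prop

variable {ι : Type*} [Fintype ι] [DecidableEq ι]

/-- The centred Gaussian measure on `ι → ℝ` with covariance matrix `K` (for positive semidefinite
`K`), as the image of the standard Gaussian measure under the square root of `K`. -/
noncomputable def gaussPi (K : Matrix ι ι ℝ) : Measure (ι → ℝ) :=
  (Measure.pi fun _ : ι => gaussianReal 0 1).map fun x => CFC.sqrt K *ᵥ x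

instance (K : Matrix ι ι ℝ) : IsProbabilityMeasure (gaussPi K) :=
  Measure.isProbabilityMeasure_map (measurable_mulVec _).aemeasurable

lemma sqrt_mul_sqrt {K : Matrix ι ι ℝ} (hK : K.PosSemidef) : CFC.sqrt K * CFC.sqrt K = K :=
  CFC.sqrt_mul_sqrt_self _ hK.nonneg

lemma sqrt_transpose (K : Matrix ι ι ℝ) : (CFC.sqrt K)ᵀ = CFC.sqrt K := by
  have h : (CFC.sqrt K).PosSemidef := Matrix.nonneg_iff_posSemidef.1 (CFC.sqrt_nonneg K)
  simpa using h.isHermitian.eq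

lemma sqrt_mulVec_dotProduct_self {K : Matrix ι ι ℝ} (hK : K.PosSemidef) (a : ι → ℝ) :
    (CFC.sqrt K *ᵥ a) ⬝ᵥ (CFC.sqrt K *ᵥ a) = a ⬝ᵥ (K *ᵥ a) := by
  conv_rhs => rw [← sqrt_mul_sqrt hK, ← Matrix.mulVec_mulVec, Matrix.dotProduct_mulVec,
    ← Matrix.mulVec_transpose, sqrt_transpose]

/-- Moving the symmetric square root onto `a` makes the integrand a product over coordinates, hence
a product of one-dimensional characteristic functions. The identities below between images of
Gaussian measures all rest on this, and it allows singular `K`. -/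
lemma integral_cexp_gaussPi {K : Matrix ι ι ℝ} (hK : K.PosSemidef) (a : ι → ℝ) :
    ∫ x, Complex.exp (((a ⬝ᵥ x : ℝ) : ℂ) * Complex.I) ∂gaussPi K =
      Complex.exp (-((a ⬝ᵥ (K *ᵥ a) : ℝ) : ℂ) / 2) := by
  have hm := measurable_dotProduct_left a
  rw [gaussPi, integral_map (measurable_mulVec _).aemeasurable (by fun_prop)]
  have h (x : ι → ℝ) : Complex.exp (((a ⬝ᵥ (CFC.sqrt K *ᵥ x) : ℝ) : ℂ) * Complex.I) =
      ∏ i, Complex.exp (((CFC.sqrt K *ᵥ a) i * x i : ℝ) * Complex.I) := by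
    rw [Matrix.dotProduct_mulVec, ← Matrix.mulVec_transpose, sqrt_transpose, ← Complex.exp_sum,
      dotProduct, Complex.ofReal_sum, Finset.sum_mul]
  simp_rw [h]
  rw [integral_fintype_prod_eq_prod
    (f := fun i (x : ℝ) => Complex.exp (((CFC.sqrt K *ᵥ a) i * x : ℝ) * Complex.I))]
  simp_rw [Complex.ofReal_mul, ← charFun_apply_real, charFun_gaussianReal]
  rw [← Complex.exp_sum, ← sqrt_mulVec_dotProduct_self hK, dotProduct]
  congr 1
  rw [Complex.ofReal_sum, ← Finset.sum_neg_distrib, Finset.sum_div]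
  refine Finset.sum_congr rfl fun i _ => ?_
  push_cast
  ring

lemma map_dotProduct_gaussPi {K : Matrix ι ι ℝ} (hK : K.PosSemidef) (a : ι → ℝ) :
    (gaussPi K).map (fun x => a ⬝ᵥ x) = gaussianReal 0 (a ⬝ᵥ (K *ᵥ a)).toNNReal := by
  have hm := measurable_dotProduct_left a
  have := Measure.isProbabilityMeasure_map (μ := gaussPi K) hm.aemeasurable
  apply Measure.ext_of_charFun
  ext t
  rw [charFun_apply_real, charFun_gaussianReal, integral_map hm.aemeasurable (by fun_prop)]
  have h := integral_cexp_gaussPi hK (t • a)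
  have h0 : 0 ≤ a ⬝ᵥ (K *ᵥ a) := by simpa using hK.dotProduct_mulVec_nonneg a
  simp only [smul_dotProduct, smul_eq_mul, Matrix.mulVec_smul, dotProduct_smul,
    Complex.ofReal_mul] at h
  rw [h]
  congr 1
  simp [Real.coe_toNNReal _ h0]
  ring_nf

lemma exists_eq_dotProduct (L : StrongDual ℝ (ι → ℝ)) : ∃ a : ι → ℝ, ∀ x, L x = a ⬝ᵥ x := by
  refine ⟨fun i => L (Pi.single i 1), fun x => ?_⟩
  rw [pi_eq_sum_univ' x, map_sum]
  simp [dotProduct, mul_comm, Pi.single_apply, Finset.sum_apply]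

lemma map_add_gaussPi {K D : Matrix ι ι ℝ} (hK : K.PosSemidef) (hD : D.PosSemidef) :
    ((gaussPi K).prod (gaussPi D)).map (fun x => x.1 + x.2) = gaussPi (K + D) := by
  have := Measure.isProbabilityMeasure_map (μ := (gaussPi K).prod (gaussPi D))
    (f := fun x => x.1 + x.2) (by fun_prop)
  apply Measure.ext_of_charFunDual
  ext L
  obtain ⟨a, hL⟩ := exists_eq_dotProduct L
  have hm := measurable_dotProduct_left a
  simp only [charFunDual_apply, hL]
  rw [integral_map (by fun_prop) (by fun_prop), integral_cexp_gaussPi (hK.add hD)]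
  have h (x : (ι → ℝ) × (ι → ℝ)) :
      Complex.exp (((a ⬝ᵥ (x.1 + x.2) : ℝ) : ℂ) * Complex.I) =
      Complex.exp (((a ⬝ᵥ x.1 : ℝ) : ℂ) * Complex.I) *
        Complex.exp (((a ⬝ᵥ x.2 : ℝ) : ℂ) * Complex.I) := by
    rw [← Complex.exp_add, dotProduct_add]; push_cast; ring_nf
  simp_rw [h]
  rw [integral_prod_mul (fun x => Complex.exp (((a ⬝ᵥ x : ℝ) : ℂ) * Complex.I))
    (fun x => Complex.exp (((a ⬝ᵥ x : ℝ) : ℂ) * Complex.I)), integral_cexp_gaussPi hK,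
    integral_cexp_gaussPi hD, ← Complex.exp_add, Matrix.add_mulVec, dotProduct_add]
  congr 1
  push_cast
  ring

lemma map_neg_gaussPi {K : Matrix ι ι ℝ} (hK : K.PosSemidef) :
    (gaussPi K).map (fun x => -x) = gaussPi K := by
  have := Measure.isProbabilityMeasure_map (μ := gaussPi K)
    (f := fun x => -x) (by fun_prop)
  apply Measure.ext_of_charFunDual
  ext L
  obtain ⟨a, hL⟩ := exists_eq_dotProduct L
  have hm := measurable_dotProduct_left a
  simp only [charFunDual_apply, hL]
  rw [integral_map (by fun_prop) (by fun_prop), integral_cexp_gaussPi hK]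
  have h := integral_cexp_gaussPi hK (-a)
  simpa [Matrix.mulVec_neg] using h

/-- A Gaussian vector `G` and an independent standard normal `T`, expressed through the standard
normal `U = (η ⬝ᵥ G - T) / c` and the independent Gaussian vector `G - U • δ`. -/
lemma map_joint_gaussPi {Ω R : Matrix ι ι ℝ} (hΩ : Ω.PosSemidef) (hR : R.PosSemidef)
    {δ η : ι → ℝ} {c : ℝ} (hRΩ : R = Ω - Matrix.vecMulVec δ δ) (hc : c ^ 2 = 1 + η ⬝ᵥ (Ω *ᵥ η))
    (hδ : Ω *ᵥ η = c • δ) :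
    ((gaussianReal 0 1).prod (gaussPi R)).map
      (fun x => (x.1 • δ + x.2, η ⬝ᵥ (x.1 • δ + x.2) - c * x.1)) =
      (gaussPi Ω).prod (gaussianReal 0 1) := by
  have hη := measurable_dotProduct_left η
  have hT : Measurable fun x : ℝ × (ι → ℝ) =>
      (x.1 • δ + x.2, η ⬝ᵥ (x.1 • δ + x.2) - c * x.1) := by
    have : Measurable fun x : ℝ × (ι → ℝ) => x.1 • δ + x.2 := by fun_prop
    exact this.prodMk ((hη.comp this).sub (by fun_prop))
  have := Measure.isProbabilityMeasure_map (μ := (gaussianReal 0 1).prod (gaussPi R))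
    hT.aemeasurable
  apply Measure.ext_of_charFunDual
  ext L
  -- A functional on the product is a pair `(a, b)`, so both characteristic functions become
  -- exponentials of quadratic forms in `a` and `b`.
  obtain ⟨a, ha⟩ := exists_eq_dotProduct (L ∘L ContinuousLinearMap.inl ℝ (ι → ℝ) ℝ)
  set b : ℝ := L (0, 1) with hb
  have hL (x : (ι → ℝ) × ℝ) : L x = a ⬝ᵥ x.1 + b * x.2 := by
    have h1 : x = ContinuousLinearMap.inl ℝ (ι → ℝ) ℝ x.1 + x.2 • ((0, 1) : (ι → ℝ) × ℝ) := by
      ext <;> simp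
    conv_lhs => rw [h1]
    rw [map_add, map_smul, ← hb, ← ha]
    simp [mul_comm]
  have hma := measurable_dotProduct_left a
  have hmab := measurable_dotProduct_left (a + b • η)
  simp only [charFunDual_apply, hL]
  rw [integral_map hT.aemeasurable (by fun_prop)]
  have h (x : ℝ × (ι → ℝ)) : Complex.exp (((a ⬝ᵥ (x.1 • δ + x.2) +
      b * (η ⬝ᵥ (x.1 • δ + x.2) - c * x.1) : ℝ) : ℂ) * Complex.I) =
      Complex.exp ((((a + b • η) ⬝ᵥ δ - b * c : ℝ) : ℂ) * x.1 * Complex.I) *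
      Complex.exp ((((a + b • η) ⬝ᵥ x.2 : ℝ) : ℂ) * Complex.I) := by
    rw [← Complex.exp_add]
    simp only [dotProduct_add, dotProduct_smul, add_dotProduct, smul_dotProduct, smul_eq_mul]
    push_cast
    ring_nf
  have h' (x : (ι → ℝ) × ℝ) : Complex.exp (((a ⬝ᵥ x.1 + b * x.2 : ℝ) : ℂ) * Complex.I) =
      Complex.exp (((a ⬝ᵥ x.1 : ℝ) : ℂ) * Complex.I) *
      Complex.exp ((b : ℂ) * x.2 * Complex.I) := by
    rw [← Complex.exp_add]
    push_cast
    ring_nf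
  simp_rw [h, h']
  rw [integral_prod_mul (fun s : ℝ => Complex.exp ((((a + b • η) ⬝ᵥ δ - b * c : ℝ) : ℂ) * s *
      Complex.I)) (fun x => Complex.exp ((((a + b • η) ⬝ᵥ x : ℝ) : ℂ) * Complex.I)),
    integral_prod_mul (fun x => Complex.exp (((a ⬝ᵥ x : ℝ) : ℂ) * Complex.I))
      (fun s : ℝ => Complex.exp ((b : ℂ) * s * Complex.I)),
    integral_cexp_gaussPi hR, integral_cexp_gaussPi hΩ, ← charFun_apply_real, ← charFun_apply_real,
    charFun_gaussianReal, charFun_gaussianReal, ← Complex.exp_add, ← Complex.exp_add]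
  have hsymm : η ⬝ᵥ (Ω *ᵥ a) = c * (a ⬝ᵥ δ) := by
    have : Ωᵀ = Ω := by simpa using hΩ.isHermitian.eq
    rw [Matrix.dotProduct_mulVec, ← Matrix.mulVec_transpose, this, hδ, smul_dotProduct,
      smul_eq_mul, dotProduct_comm]
  have hq : c * (η ⬝ᵥ δ) = c ^ 2 - 1 := by
    rw [hc, hδ, dotProduct_smul, smul_eq_mul]; ring
  -- The square of `(a + b • η) ⬝ᵥ δ` cancels against the `-δ δᵀ` in `R`, the mixed terms cancel by
  -- `Ω η = c δ`, and the coefficient left on `b ^ 2` is `c ^ 2 - c (η ⬝ᵥ δ) = 1`.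
  have key : ((a + b • η) ⬝ᵥ δ - b * c) ^ 2 + (a + b • η) ⬝ᵥ (R *ᵥ (a + b • η)) =
      a ⬝ᵥ (Ω *ᵥ a) + b ^ 2 := by
    have hv : Matrix.vecMulVec δ δ *ᵥ (a + b • η) = ((a + b • η) ⬝ᵥ δ) • δ := by
      rw [Matrix.vecMulVec_mulVec, dotProduct_comm, op_smul_eq_smul]
    rw [hRΩ, Matrix.sub_mulVec, dotProduct_sub, hv, dotProduct_smul]
    simp only [Matrix.mulVec_add, Matrix.mulVec_smul, hδ, dotProduct_add, dotProduct_smul,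
      add_dotProduct, smul_dotProduct, smul_eq_mul, hsymm]
    linear_combination (-(b ^ 2)) * hq
  congr 1
  have key' := congrArg (fun r : ℝ => (r : ℂ)) key
  push_cast at key' ⊢
  linear_combination (-1/2 : ℂ) * key'

lemma pi_gaussianReal_eq_withDensity {ι : Type*} [Fintype ι] :
    (Measure.pi fun _ : ι => gaussianReal 0 1) =
      volume.withDensity fun x : ι → ℝ => ENNReal.ofReal (∏ i, gaussianPDFReal 0 1 (x i)) := by
  refine Measure.pi_eq fun s hs => ?_
  rw [withDensity_apply _ (MeasurableSet.univ_pi hs), volume_pi, Measure.restrict_pi_pi,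
    ← ofReal_integral_eq_lintegral_ofReal, integral_fintype_prod_eq_prod
      (f := fun _ x => gaussianPDFReal 0 1 x),
    ENNReal.ofReal_prod_of_nonneg]
  · refine Finset.prod_congr rfl fun i _ => ?_
    rw [gaussianReal_apply_eq_integral 0 one_ne_zero]
  · exact fun i _ => integral_nonneg fun x => gaussianPDFReal_nonneg 0 1 x
  · exact Integrable.fintype_prod fun i => (integrable_gaussianPDFReal 0 1).restrict
  · exact ae_of_all _ fun x => Finset.prod_nonneg fun i _ => gaussianPDFReal_nonneg 0 1 (x i)

lemma measurable_normalDensity (μ : ι → ℝ) (Ω : Matrix ι ι ℝ) :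
    Measurable (normalDensity μ Ω) := by
  unfold normalDensity dotProduct
  have := measurable_mulVec Ω⁻¹
  fun_prop

lemma normalDensity_nonneg (μ : ι → ℝ) (Ω : Matrix ι ι ℝ) (z : ι → ℝ) :
    0 ≤ normalDensity μ Ω z := by
  unfold normalDensity; positivity

/-- With `A * A = Ω` and `z = A x`, the form `zᵀ Ω⁻¹ z` becomes the sum of the `x i ^ 2`, and `√(det
Ω) = |det A|` is the Jacobian factor. -/
lemma prod_gaussianPDFReal_eq {Ω : Matrix ι ι ℝ} (hΩ : Ω.PosDef) (x : ι → ℝ) :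
    ∏ i, gaussianPDFReal 0 1 (x i) = |(CFC.sqrt Ω).det| * normalDensity 0 Ω (CFC.sqrt Ω *ᵥ x) := by
  set A := CFC.sqrt Ω with hA
  have hAA : A * A = Ω := sqrt_mul_sqrt hΩ.posSemidef
  have hdet : A.det * A.det = Ω.det := by rw [← Matrix.det_mul, hAA]
  have hA0 : A.det ≠ 0 := fun h => hΩ.det_pos.ne' (by rw [← hdet, h, zero_mul])
  have hU : IsUnit A.det := isUnit_iff_ne_zero.2 hA0
  have hexp : (A *ᵥ x) ⬝ᵥ (Ω⁻¹ *ᵥ (A *ᵥ x)) = ∑ i, x i ^ 2 := by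
    rw [← hAA, Matrix.mul_inv_rev, ← Matrix.mulVec_mulVec, Matrix.mulVec_mulVec x A⁻¹ A,
      Matrix.nonsing_inv_mul A hU, Matrix.one_mulVec, Matrix.dotProduct_mulVec,
      ← Matrix.mulVec_transpose, Matrix.mulVec_mulVec, Matrix.transpose_nonsing_inv,
      sqrt_transpose, Matrix.nonsing_inv_mul A hU, Matrix.one_mulVec]
    simp [dotProduct, sq]
  have hsq : √((2 * Real.pi) ^ Fintype.card ι * Ω.det) =
      √(2 * Real.pi) ^ Fintype.card ι * |A.det| := by
    rw [← hdet, Real.sqrt_mul (by positivity), Real.sqrt_mul_self_eq_abs]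
    congr 1
    rw [Real.sqrt_eq_iff_mul_self_eq (by positivity) (by positivity), ← mul_pow,
      Real.mul_self_sqrt (by positivity)]
  unfold normalDensity
  rw [sub_zero, hexp, hsq]
  simp only [gaussianPDFReal_def, Finset.prod_mul_distrib, Finset.prod_const, ← Real.exp_sum]
  have : |A.det| ≠ 0 := abs_ne_zero.2 hA0
  simp only [Finset.card_univ, sub_zero, NNReal.coe_one, mul_one, Finset.mul_sum]
  rw [mul_inv, ← inv_pow]
  field_simp

/-- Links the image-measure description, suited to characteristic functions, with the density from
which the skew-normal law is built. -/
lemma gaussPi_eq_withDensity {Ω : Matrix ι ι ℝ} (hΩ : Ω.PosDef) :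
    gaussPi Ω = volume.withDensity fun z => ENNReal.ofReal (normalDensity 0 Ω z) := by
  have hdet : (CFC.sqrt Ω).det ≠ 0 := fun h => hΩ.det_pos.ne' (by
    rw [← sqrt_mul_sqrt hΩ.posSemidef, Matrix.det_mul, h, zero_mul])
  have hmap := Real.map_matrix_volume_pi_eq_smul_volume_pi hdet
  have hn := measurable_normalDensity 0 Ω
  have hA := measurable_mulVec (CFC.sqrt Ω)
  ext s hs
  rw [gaussPi, Measure.map_apply hA hs, pi_gaussianReal_eq_withDensity,
    withDensity_apply _ (hA hs), withDensity_apply _ hs]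
  simp_rw [prod_gaussianPDFReal_eq hΩ, ENNReal.ofReal_mul (abs_nonneg _)]
  rw [lintegral_const_mul _ (by fun_prop)]
  have h1 : ∫⁻ x in s, ENNReal.ofReal (normalDensity 0 Ω x)
      ∂(Measure.map (Matrix.toLin' (CFC.sqrt Ω)) volume) =
      ∫⁻ x in (fun x => CFC.sqrt Ω *ᵥ x) ⁻¹' s,
        ENNReal.ofReal (normalDensity 0 Ω (CFC.sqrt Ω *ᵥ x)) :=
    setLIntegral_map hs (by fun_prop) hA
  rw [← h1, hmap, Measure.restrict_smul, lintegral_smul_measure, smul_eq_mul, ← mul_assoc,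
    ← ENNReal.ofReal_mul (abs_nonneg _), ← abs_mul, mul_inv_cancel₀ hdet]
  simp

end GaussianVectors

/-! ### Skew-normal vectors and their stochastic representation. -/

section SkewNormalVectors

open scoped MatrixOrder

variable {ι : Type*} [Fintype ι] [DecidableEq ι]

lemma isUnit_det_scaleDiag {Ω : Matrix ι ι ℝ} (hΩ : Ω.PosDef) : IsUnit (scaleDiag Ω).det := by
  rw [scaleDiag, Matrix.det_diagonal, isUnit_iff_ne_zero, Finset.prod_ne_zero_iff]
  exact fun i _ => (Real.sqrt_pos.2 hΩ.diag_pos).ne'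

lemma scaleDiag_inv_transpose (Ω : Matrix ι ι ℝ) : ((scaleDiag Ω)⁻¹)ᵀ = (scaleDiag Ω)⁻¹ := by
  rw [Matrix.transpose_nonsing_inv, scaleDiag, Matrix.diagonal_transpose]

lemma dotProduct_scaleDiag_inv_mulVec (Ω : Matrix ι ι ℝ) (α x : ι → ℝ) :
    α ⬝ᵥ ((scaleDiag Ω)⁻¹ *ᵥ x) = ((scaleDiag Ω)⁻¹ *ᵥ α) ⬝ᵥ x := by
  rw [Matrix.dotProduct_mulVec, ← Matrix.mulVec_transpose, scaleDiag_inv_transpose]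

lemma dotProduct_corr_mulVec (Ω : Matrix ι ι ℝ) (α : ι → ℝ) :
    α ⬝ᵥ (corr Ω *ᵥ α) =
      ((scaleDiag Ω)⁻¹ *ᵥ α) ⬝ᵥ (Ω *ᵥ ((scaleDiag Ω)⁻¹ *ᵥ α)) := by
  rw [corr, ← Matrix.mulVec_mulVec, ← Matrix.mulVec_mulVec, dotProduct_scaleDiag_inv_mulVec]

lemma dotProduct_mulVec_self_nonneg {ι : Type*} [Fintype ι] {Ω : Matrix ι ι ℝ}
    (hΩ : Ω.PosSemidef) (x : ι → ℝ) : 0 ≤ x ⬝ᵥ (Ω *ᵥ x) := by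
  simpa using hΩ.dotProduct_mulVec_nonneg x

/-- This is the relation `c δ = Ω η` with `η = ω⁻¹ α`, in the form needed by `map_joint_gaussPi`. -/
lemma sqrt_smul_deltaParam {Ω : Matrix ι ι ℝ} (hΩ : Ω.PosDef) (α : ι → ℝ) :
    √(1 + α ⬝ᵥ (corr Ω *ᵥ α)) • deltaParam Ω α = Ω *ᵥ ((scaleDiag Ω)⁻¹ *ᵥ α) := by
  have h0 : 0 < 1 + α ⬝ᵥ (corr Ω *ᵥ α) := by
    rw [dotProduct_corr_mulVec]
    linarith [dotProduct_mulVec_self_nonneg hΩ.posSemidef ((scaleDiag Ω)⁻¹ *ᵥ α)]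
  rw [deltaParam, smul_smul, mul_inv_cancel₀ (Real.sqrt_pos.2 h0).ne', one_smul, corr,
    ← Matrix.mul_assoc, ← Matrix.mul_assoc, Matrix.mul_nonsing_inv _ (isUnit_det_scaleDiag hΩ),
    Matrix.one_mul, Matrix.mulVec_mulVec]

/-- The conditional covariance matrix `Ω - δ δᵀ` is positive semidefinite. -/
lemma posSemidef_sub_vecMulVec_deltaParam {Ω : Matrix ι ι ℝ} (hΩ : Ω.PosDef) (α : ι → ℝ) :
    (Ω - Matrix.vecMulVec (deltaParam Ω α) (deltaParam Ω α)).PosSemidef := by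
  have hherm : (Ω - Matrix.vecMulVec (deltaParam Ω α) (deltaParam Ω α)).IsHermitian := by
    refine hΩ.isHermitian.sub ?_
    ext i j
    simp [Matrix.vecMulVec_apply, mul_comm]
  refine Matrix.PosSemidef.of_dotProduct_mulVec_nonneg hherm fun x => ?_
  set η := (scaleDiag Ω)⁻¹ *ᵥ α
  set δ := deltaParam Ω α
  set q := η ⬝ᵥ (Ω *ᵥ η) with hq
  have hq0 : 0 ≤ q := dotProduct_mulVec_self_nonneg hΩ.posSemidef η
  have hδ : √(1 + q) • δ = Ω *ᵥ η := by
    rw [hq, ← dotProduct_corr_mulVec]; exact sqrt_smul_deltaParam hΩ α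
  -- Cauchy–Schwarz for the form `Ω`. Since `Ω η = √(1 + q) δ`, it bounds `(1 + q) (x ⬝ᵥ δ) ^ 2` by
  -- `q (xᵀ Ω x)`, hence by `(1 + q) (xᵀ Ω x)`.
  have hcs : (x ⬝ᵥ (Ω *ᵥ η)) ^ 2 ≤ (x ⬝ᵥ (Ω *ᵥ x)) * q := by
    have h1 (y z : ι → ℝ) : y ⬝ᵥ (Ω *ᵥ z) = (CFC.sqrt Ω *ᵥ y) ⬝ᵥ (CFC.sqrt Ω *ᵥ z) := by
      conv_lhs => rw [← sqrt_mul_sqrt hΩ.posSemidef, ← Matrix.mulVec_mulVec,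
        Matrix.dotProduct_mulVec, ← Matrix.mulVec_transpose, sqrt_transpose]
    rw [hq, h1, h1, h1]
    simpa only [dotProduct, sq] using Finset.sum_mul_sq_le_sq_mul_sq Finset.univ
      (CFC.sqrt Ω *ᵥ x) (CFC.sqrt Ω *ᵥ η)
  have hx0 := dotProduct_mulVec_self_nonneg hΩ.posSemidef x
  rw [← hδ, dotProduct_smul, smul_eq_mul, mul_pow, Real.sq_sqrt (by linarith)] at hcs
  have hfin : (x ⬝ᵥ δ) ^ 2 ≤ x ⬝ᵥ (Ω *ᵥ x) := by
    have h2 : (1 + q) * (x ⬝ᵥ δ) ^ 2 ≤ (1 + q) * (x ⬝ᵥ (Ω *ᵥ x)) := by linarith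
    exact le_of_mul_le_mul_left h2 (by linarith)
  have hstar : star x = x := by ext i; simp
  rw [hstar, Matrix.sub_mulVec, dotProduct_sub, Matrix.vecMulVec_mulVec, op_smul_eq_smul,
    dotProduct_smul, smul_eq_mul, dotProduct_comm δ x]
  linarith

/-- The distribution of the absolute value of a standard normal variable. -/
noncomputable def halfNormal : Measure ℝ := (2 : ℝ≥0∞) • (gaussianReal 0 1).restrict (Set.Ici 0)

instance : IsFiniteMeasure halfNormal := by
  unfold halfNormal
  exact Measure.smul_finite _ (by simp)

/-- The skew-normal distribution on `ι → ℝ`. -/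
noncomputable def skewPi (m : ι → ℝ) (Ω : Matrix ι ι ℝ) (α : ι → ℝ) : Measure (ι → ℝ) :=
  volume.withDensity fun z => ENNReal.ofReal
    (2 * normalDensity m Ω z * stdNormalCDF (α ⬝ᵥ ((scaleDiag Ω)⁻¹ *ᵥ (z - m))))

lemma measurable_stdNormalCDF : Measurable stdNormalCDF :=
  (monotone_cdf (gaussianReal 0 1)).measurable

lemma measurable_skewPi_density (m : ι → ℝ) (Ω : Matrix ι ι ℝ) (α : ι → ℝ) :
    Measurable fun z => ENNReal.ofReal
      (2 * normalDensity m Ω z * stdNormalCDF (α ⬝ᵥ ((scaleDiag Ω)⁻¹ *ᵥ (z - m)))) := by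
  have h1 := measurable_normalDensity m Ω
  have h2 : Measurable fun z => α ⬝ᵥ ((scaleDiag Ω)⁻¹ *ᵥ (z - m)) :=
    (measurable_dotProduct_left α).comp ((measurable_mulVec _).comp (by fun_prop))
  have h3 := measurable_stdNormalCDF.comp h2
  exact ((h1.const_mul 2).mul h3).ennreal_ofReal

/-- The stochastic representation `m + |U| δ + R` of the skew-normal distribution, with `U` standard
normal and `R` an independent centred Gaussian vector with covariance matrix `Ω - δ δᵀ`. -/
theorem skewPi_eq_map {Ω : Matrix ι ι ℝ} (hΩ : Ω.PosDef) (m α : ι → ℝ) :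
    skewPi m Ω α = (halfNormal.prod (gaussPi
      (Ω - Matrix.vecMulVec (deltaParam Ω α) (deltaParam Ω α)))).map
        fun x => m + (x.1 • deltaParam Ω α + x.2) := by
  set δ := deltaParam Ω α with hδdef
  set R := Ω - Matrix.vecMulVec δ δ with hR
  set η := (scaleDiag Ω)⁻¹ *ᵥ α with hη
  have hq0 : 0 ≤ η ⬝ᵥ (Ω *ᵥ η) := dotProduct_mulVec_self_nonneg hΩ.posSemidef η
  set c := √(1 + η ⬝ᵥ (Ω *ᵥ η)) with hc
  have hc0 : 0 < c := Real.sqrt_pos.2 (by linarith)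
  have hδ : Ω *ᵥ η = c • δ := by
    rw [hc, hη, ← dotProduct_corr_mulVec]; exact (sqrt_smul_deltaParam hΩ α).symm
  have hjoint := map_joint_gaussPi hΩ.posSemidef
    (posSemidef_sub_vecMulVec_deltaParam hΩ α) hR (Real.sq_sqrt (by linarith)) hδ
  have hηm := measurable_dotProduct_left η
  refine Measure.ext_of_lintegral _ fun h hh => ?_
  have hset : MeasurableSet {y : (ι → ℝ) × ℝ | y.2 ≤ η ⬝ᵥ y.1} :=
    measurableSet_le measurable_snd (hηm.comp measurable_fst)
  have hT : Measurable fun x : ℝ × (ι → ℝ) =>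
      (x.1 • δ + x.2, η ⬝ᵥ (x.1 • δ + x.2) - c * x.1) := by
    have : Measurable fun x : ℝ × (ι → ℝ) => x.1 • δ + x.2 := by fun_prop
    exact this.prodMk ((hηm.comp this).sub (by fun_prop))
  have hG : Measurable fun x => ENNReal.ofReal (stdNormalCDF (η ⬝ᵥ x)) :=
    (measurable_stdNormalCDF.comp hηm).ennreal_ofReal
  have hn := measurable_normalDensity (0 : ι → ℝ) Ω
  calc ∫⁻ z, h z ∂skewPi m Ω α
      = ∫⁻ z, ENNReal.ofReal (2 * normalDensity m Ω z *
          stdNormalCDF (α ⬝ᵥ ((scaleDiag Ω)⁻¹ *ᵥ (z - m)))) * h z := by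
        rw [skewPi, lintegral_withDensity_eq_lintegral_mul _ (measurable_skewPi_density m Ω α) hh]
        rfl
    _ = ∫⁻ x, ENNReal.ofReal (2 * normalDensity m Ω (m + x) *
          stdNormalCDF (α ⬝ᵥ ((scaleDiag Ω)⁻¹ *ᵥ (m + x - m)))) * h (m + x) :=
        (lintegral_add_left_eq_self _ m).symm
    _ = ∫⁻ x, ENNReal.ofReal (normalDensity 0 Ω x) *
          (2 * h (m + x) * ENNReal.ofReal (stdNormalCDF (η ⬝ᵥ x))) := by
        refine lintegral_congr fun x => ?_
        have h1 : normalDensity m Ω (m + x) = normalDensity 0 Ω x := by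
          simp [normalDensity]
        rw [h1, add_sub_cancel_left, dotProduct_scaleDiag_inv_mulVec, mul_assoc 2,
          ENNReal.ofReal_mul (by norm_num), ENNReal.ofReal_mul (normalDensity_nonneg _ _ _)]
        simp only [ENNReal.ofReal_ofNat]
        ring
    _ = ∫⁻ x, 2 * h (m + x) * ENNReal.ofReal (stdNormalCDF (η ⬝ᵥ x)) ∂gaussPi Ω := by
        rw [gaussPi_eq_withDensity hΩ, lintegral_withDensity_eq_lintegral_mul _ (by fun_prop)
          (by fun_prop)]
        rfl
    -- The factor `Φ(η ⬝ᵥ x)` is the probability that an independent standard normal `T` satisfies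
    -- `T ≤ η ⬝ᵥ x`: skewing is restriction to a half-space.
    _ = ∫⁻ y in {y : (ι → ℝ) × ℝ | y.2 ≤ η ⬝ᵥ y.1}, 2 * h (m + y.1)
          ∂(gaussPi Ω).prod (gaussianReal 0 1) := by
        rw [← lintegral_indicator hset, lintegral_prod _
          ((Measurable.indicator (by fun_prop) hset).aemeasurable)]
        refine lintegral_congr fun x => ?_
        have h1 (t : ℝ) : Set.indicator {y : (ι → ℝ) × ℝ | y.2 ≤ η ⬝ᵥ y.1}
            (fun y => 2 * h (m + y.1)) (x, t) =
            (Set.Iic (η ⬝ᵥ x)).indicator (fun _ => 2 * h (m + x)) t := by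
          simp [Set.indicator]
        simp_rw [h1]
        rw [lintegral_indicator_const measurableSet_Iic, stdNormalCDF, ofReal_cdf]
    -- In the coordinates `(U, R)` one has `T = η ⬝ᵥ G - c U`, so, as `c > 0`, the event `T ≤ η ⬝ᵥ
    -- G` is just `U ≥ 0`.
    _ = ∫⁻ x in Set.Ici 0 ×ˢ Set.univ, 2 * h (m + (x.1 • δ + x.2))
          ∂(gaussianReal 0 1).prod (gaussPi R) := by
        rw [← hjoint, setLIntegral_map hset (by fun_prop) hT]
        congr 2
        ext x
        simp [hc0]
    _ = ∫⁻ z, h z ∂(halfNormal.prod (gaussPi R)).map fun x => m + (x.1 • δ + x.2) := by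
        rw [lintegral_map hh (by fun_prop), halfNormal, Measure.prod_smul_left,
          lintegral_smul_measure, lintegral_const_mul _ (by fun_prop), ← Measure.prod_restrict,
          Measure.restrict_univ, smul_eq_mul]

end SkewNormalVectors

/-! ### Extended expectations of convex functions. -/

section ExtendedExpectation

lemma extExpectation_eq_integral {S : Type*} [MeasurableSpace S] {P : Measure S} {g : S → ℝ}
    (hg : Integrable g P) : extExpectation P g = ((∫ s, g s ∂P : ℝ) : EReal) := by
  have h1 : ∫⁻ s, ENNReal.ofReal (g s) ∂P ≠ ∞ := hg.lintegral_lt_top.ne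
  have h2 : ∫⁻ s, ENNReal.ofReal (-g s) ∂P ≠ ∞ := hg.neg.lintegral_lt_top.ne
  rw [extExpectation, integral_eq_lintegral_pos_part_sub_lintegral_neg_part hg, EReal.coe_sub,
    EReal.coe_ennreal_toReal h1, EReal.coe_ennreal_toReal h2]

lemma expectationWellDefined_of_integrable {S : Type*} [MeasurableSpace S] {P : Measure S}
    {g : S → ℝ} (hg : Integrable g P) : ExpectationWellDefined P g :=
  Or.inl hg.lintegral_lt_top.ne

lemma extExpectation_comp_of_hasLaw {S E : Type*} [MeasurableSpace S] [MeasurableSpace E]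
    {P : Measure S} {μ : Measure E} {X : S → E} (hX : HasLaw X μ P) {g : E → ℝ}
    (hg : Measurable g) : extExpectation P (fun s => g (X s)) = extExpectation μ g := by
  have hg' : Measurable fun x => -g x := hg.neg
  rw [extExpectation, extExpectation, ← hX.map_eq,
    lintegral_map' hg.ennreal_ofReal.aemeasurable hX.aemeasurable,
    lintegral_map' hg'.ennreal_ofReal.aemeasurable hX.aemeasurable]

variable {E : Type*} [NormedAddCommGroup E] [NormedSpace ℝ E]

lemma two_mul_le_of_convexOn {g : E → ℝ} (hg : ConvexOn ℝ Set.univ g) (x w : E) :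
    2 * g x ≤ g (x + w) + g (x - w) := by
  have h := hg.2 (Set.mem_univ (x + w)) (Set.mem_univ (x - w))
    (show (0 : ℝ) ≤ 1 / 2 by norm_num) (show (0 : ℝ) ≤ 1 / 2 by norm_num) (by norm_num)
  have hx : (1 / 2 : ℝ) • (x + w) + (1 / 2 : ℝ) • (x - w) = x := by module
  rw [hx, smul_eq_mul, smul_eq_mul] at h
  linarith

variable [FiniteDimensional ℝ E]

lemma exists_affine_le_of_convexOn {g : E → ℝ} (hg : ConvexOn ℝ Set.univ g) :
    ∃ (l : StrongDual ℝ E) (c : ℝ), ∀ x, l x + c ≤ g x := by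
  obtain ⟨l, c, h, -⟩ := hg.exists_affine_le_of_lt (𝕜 := ℝ) (Set.mem_univ 0)
    (show g 0 - 1 < g 0 by linarith) isClosed_univ
    (hg.continuousOn isOpen_univ).lowerSemicontinuousOn
  exact ⟨l, c, fun x => by simpa using h ⟨x, Set.mem_univ x⟩⟩

variable [MeasurableSpace E]

/-- An affine minorant of `g` is integrable and controls its negative part, so only the positive
part can have infinite integral. -/
lemma lintegral_neg_part_ne_top {g : E → ℝ} (hg : ConvexOn ℝ Set.univ g) {μ : Measure E}
    [IsFiniteMeasure μ] (hμ : ∀ l : StrongDual ℝ E, Integrable l μ) :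
    ∫⁻ x, ENNReal.ofReal (-g x) ∂μ ≠ ∞ := by
  obtain ⟨l, c, h⟩ := exists_affine_le_of_convexOn hg
  have hi : Integrable (fun x => -(l x + c)) μ := ((hμ l).add (integrable_const c)).neg
  refine ne_top_of_le_ne_top hi.lintegral_lt_top.ne (lintegral_mono fun x => ?_)
  exact ENNReal.ofReal_le_ofReal (by linarith [h x])

lemma integrable_of_lintegral_ne_top {S : Type*} [MeasurableSpace S] {P : Measure S} {g : S → ℝ}
    (hg : AEStronglyMeasurable g P) (h1 : ∫⁻ s, ENNReal.ofReal (g s) ∂P ≠ ∞)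
    (h2 : ∫⁻ s, ENNReal.ofReal (-g s) ∂P ≠ ∞) : Integrable g P := by
  refine ⟨hg, ?_⟩
  rw [hasFiniteIntegral_iff_norm]
  have h (s : S) : ENNReal.ofReal ‖g s‖ = ENNReal.ofReal (g s) + ENNReal.ofReal (-g s) := by
    rcases le_total 0 (g s) with h | h
    · rw [Real.norm_of_nonneg h, ENNReal.ofReal_of_nonpos (neg_nonpos.2 h), add_zero]
    · rw [Real.norm_of_nonpos h, ENNReal.ofReal_of_nonpos h, zero_add]
  simp_rw [h]
  rw [lintegral_add_left' hg.aemeasurable.ennreal_ofReal]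
  exact ENNReal.add_lt_top.2 ⟨h1.lt_top, h2.lt_top⟩

variable [BorelSpace E]

/-- Adding independent symmetric noise increases the expectation of convex functions. -/
theorem extExpectation_le_of_symmetric_noise {g : E → ℝ} (hg : ConvexOn ℝ Set.univ g)
    {μ κ ν : Measure E} [IsFiniteMeasure μ] [IsProbabilityMeasure κ]
    (hκ : κ.map (fun w => -w) = κ) (hν : ν = (μ.prod κ).map fun x => x.1 + x.2)
    (hμ : ∀ l : StrongDual ℝ E, Integrable l μ) (hνi : ∀ l : StrongDual ℝ E, Integrable l ν) :
    extExpectation μ g ≤ extExpectation ν g := by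
  have hcont : Continuous g := continuousOn_univ.1 (hg.continuousOn isOpen_univ)
  have : ProperSpace E := FiniteDimensional.proper ℝ E
  have : SecondCountableTopology E := secondCountable_of_proper
  have hadd : Measurable fun x : E × E => x.1 + x.2 := by fun_prop
  have : IsFiniteMeasure ν := by rw [hν]; infer_instance
  have hμn := lintegral_neg_part_ne_top hg hμ
  have hνn := lintegral_neg_part_ne_top hg hνi
  have hflip : MeasurePreserving (fun x : E × E => (x.1, -x.2)) (μ.prod κ) (μ.prod κ) :=
    (MeasurePreserving.id μ).prod ⟨measurable_neg, hκ⟩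
  have hpres : MeasurePreserving (fun x : E × E => x.1 + x.2) (μ.prod κ) ν := ⟨hadd, hν.symm⟩
  -- Symmetry of the noise: `x - w` has the same law as `x + w`.
  have hpres' : MeasurePreserving (fun x : E × E => x.1 - x.2) (μ.prod κ) ν := by
    simpa [Function.comp_def, sub_eq_add_neg] using hpres.comp hflip
  have hfst : MeasurePreserving (Prod.fst : E × E → E) (μ.prod κ) μ := measurePreserving_fst
  have hm : Measurable fun x => ENNReal.ofReal (g x) := hcont.measurable.ennreal_ofReal
  by_cases hνp : ∫⁻ x, ENNReal.ofReal (g x) ∂ν = ∞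
  · have : extExpectation ν g = ⊤ := by
      rw [extExpectation, hνp, ← EReal.coe_ennreal_toReal hνn]
      exact EReal.top_sub_coe _
    rw [this]
    exact le_top
  -- Convexity bounds the positive part of `g x` by the sum of those of `g (x + w)` and `g (x - w)`,
  -- so finiteness passes from `ν` to `μ`.
  have hμp : ∫⁻ x, ENNReal.ofReal (g x) ∂μ ≠ ∞ := by
    have hle : ∫⁻ x, ENNReal.ofReal (g x) ∂μ ≤
        ∫⁻ x, ENNReal.ofReal (g x) ∂ν + ∫⁻ x, ENNReal.ofReal (g x) ∂ν := by
      calc ∫⁻ x, ENNReal.ofReal (g x) ∂μ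
          = ∫⁻ x : E × E, ENNReal.ofReal (g x.1) ∂μ.prod κ := (hfst.lintegral_comp hm).symm
        _ ≤ ∫⁻ x : E × E, ENNReal.ofReal (g (x.1 + x.2)) + ENNReal.ofReal (g (x.1 - x.2))
              ∂μ.prod κ := ?_
        _ = ∫⁻ x, ENNReal.ofReal (g x) ∂ν + ∫⁻ x, ENNReal.ofReal (g x) ∂ν := by
          rw [lintegral_add_left (f := fun x : E × E => ENNReal.ofReal (g (x.1 + x.2)))
            (hm.comp hpres.measurable)]
          exact congrArg₂ _ (hpres.lintegral_comp hm) (hpres'.lintegral_comp hm)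
      refine lintegral_mono fun x => ?_
      rcases le_total (g x.1) 0 with h | h
      · simp [ENNReal.ofReal_of_nonpos h]
      · refine le_trans (ENNReal.ofReal_le_ofReal ?_) ENNReal.ofReal_add_le
        linarith [two_mul_le_of_convexOn hg x.1 x.2]
    exact ne_top_of_le_ne_top (ENNReal.add_ne_top.2 ⟨hνp, hνp⟩) hle
  have hgμ := integrable_of_lintegral_ne_top hcont.aestronglyMeasurable hμp hμn
  have hgν := integrable_of_lintegral_ne_top hcont.aestronglyMeasurable hνp hνn
  rw [extExpectation_eq_integral hgμ, extExpectation_eq_integral hgν, EReal.coe_le_coe_iff]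
  have i0 : Integrable (fun x : E × E => g x.1) (μ.prod κ) := hfst.integrable_comp_of_integrable hgμ
  have i1 : Integrable (fun x : E × E => g (x.1 + x.2)) (μ.prod κ) :=
    hpres.integrable_comp_of_integrable hgν
  have i2 : Integrable (fun x : E × E => g (x.1 - x.2)) (μ.prod κ) :=
    hpres'.integrable_comp_of_integrable hgν
  have e0 : ∫ x, g x ∂μ = ∫ x : E × E, g x.1 ∂μ.prod κ := by
    rw [← hfst.map_eq, integral_map hfst.measurable.aemeasurable hcont.aestronglyMeasurable,
      hfst.map_eq]
  have e1 : ∫ x, g x ∂ν = ∫ x : E × E, g (x.1 + x.2) ∂μ.prod κ := by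
    rw [← hpres.map_eq, integral_map hpres.measurable.aemeasurable hcont.aestronglyMeasurable]
  have e2 : ∫ x, g x ∂ν = ∫ x : E × E, g (x.1 - x.2) ∂μ.prod κ := by
    rw [← hpres'.map_eq, integral_map hpres'.measurable.aemeasurable hcont.aestronglyMeasurable]
  have hle := integral_mono (i0.const_mul 2) (i1.add i2)
    (fun x => two_mul_le_of_convexOn hg x.1 x.2)
  simp only [Pi.add_apply] at hle
  rw [integral_const_mul, integral_add i1 i2, ← e0, ← e1, ← e2] at hle
  linarith

end ExtendedExpectation

/-! ### First and second moments; the noise decomposition. -/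

section Moments

variable {ι : Type*} [Fintype ι] [DecidableEq ι]

lemma memLp_id_halfNormal : MemLp (fun s : ℝ => s) 2 halfNormal :=
  ((memLp_id_gaussianReal 2).restrict _).smul_measure (by simp)

lemma memLp_dotProduct_gaussPi {K : Matrix ι ι ℝ} (hK : K.PosSemidef) (a : ι → ℝ) :
    MemLp (fun x => a ⬝ᵥ x) 2 (gaussPi K) := by
  have h : MemLp id 2 ((gaussPi K).map fun x => a ⬝ᵥ x) := by
    rw [map_dotProduct_gaussPi hK]
    exact memLp_id_gaussianReal 2
  exact (memLp_map_measure_iff aestronglyMeasurable_id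
    (measurable_dotProduct_left a).aemeasurable).1 h

lemma integral_dotProduct_gaussPi {K : Matrix ι ι ℝ} (hK : K.PosSemidef) (a : ι → ℝ) :
    ∫ x, a ⬝ᵥ x ∂gaussPi K = 0 := by
  have h : ∫ y, y ∂((gaussPi K).map fun x => a ⬝ᵥ x) = 0 := by
    rw [map_dotProduct_gaussPi hK, integral_id_gaussianReal]
  rwa [integral_map (measurable_dotProduct_left a).aemeasurable (by fun_prop)] at h

lemma integral_dotProduct_sq_gaussPi {K : Matrix ι ι ℝ} (hK : K.PosSemidef) (a : ι → ℝ) :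
    ∫ x, (a ⬝ᵥ x) ^ 2 ∂gaussPi K = a ⬝ᵥ (K *ᵥ a) := by
  have h : ∫ y, y ^ 2 ∂((gaussPi K).map fun x => a ⬝ᵥ x) = a ⬝ᵥ (K *ᵥ a) := by
    have h1 := variance_fun_id_gaussianReal (μ := 0) (v := (a ⬝ᵥ (K *ᵥ a)).toNNReal)
    rw [variance_eq_integral (by fun_prop)] at h1
    simp only [integral_id_gaussianReal, sub_zero] at h1
    rw [map_dotProduct_gaussPi hK, h1, Real.coe_toNNReal _ (dotProduct_mulVec_self_nonneg hK a)]
  rwa [integral_map (measurable_dotProduct_left a).aemeasurable (by fun_prop)] at h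

/-- The mass is in fact 1, but positivity suffices: it is only cancelled from an inequality. The
same holds for the mean below. -/
lemma halfNormal_real_univ_pos : 0 < halfNormal.real Set.univ := by
  rw [measureReal_def]
  refine ENNReal.toReal_pos ?_ (measure_ne_top _ _)
  simp only [halfNormal, Measure.smul_apply, Measure.restrict_apply_univ, smul_eq_mul]
  refine mul_ne_zero (by simp) fun h => ?_
  have := gaussianReal_absolutelyContinuous' 0 one_ne_zero h
  simp at this

lemma integral_halfNormal_pos : 0 < ∫ s, s ∂halfNormal := by
  have hpos : ∀ᵐ s ∂halfNormal, 0 ≤ s := by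
    unfold halfNormal
    exact Measure.ae_smul_measure (ae_restrict_mem measurableSet_Ici) _
  rw [integral_pos_iff_support_of_nonneg_ae hpos (memLp_id_halfNormal.integrable (by norm_num))]
  refine pos_iff_ne_zero.2 fun h => ?_
  simp only [halfNormal, Measure.smul_apply, smul_eq_mul, mul_eq_zero, OfNat.ofNat_ne_zero,
    false_or] at h
  -- A null support would make the positive half-line Gaussian-null, hence Lebesgue-null.
  have h2 : gaussianReal 0 1 (Set.Ioi 0) = 0 := by
    refine measure_mono_null (fun x hx => ?_) (nonpos_iff_eq_zero.1
      ((Measure.le_restrict_apply _ _).trans h.le))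
    exact ⟨ne_of_gt (Set.mem_Ioi.1 hx), (Set.mem_Ioi.1 hx).le⟩
  have := gaussianReal_absolutelyContinuous' 0 one_ne_zero h2
  simp at this

lemma memLp_dotProduct_skewPi {Ω : Matrix ι ι ℝ} (hΩ : Ω.PosDef) (m α a : ι → ℝ) :
    MemLp (fun x => a ⬝ᵥ x) 2 (skewPi m Ω α) := by
  rw [skewPi_eq_map hΩ, memLp_map_measure_iff
    (measurable_dotProduct_left a).aestronglyMeasurable (by fun_prop)]
  have hR := posSemidef_sub_vecMulVec_deltaParam hΩ α
  have h1 := (memLp_id_halfNormal.comp_fst (gaussPi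
    (Ω - Matrix.vecMulVec (deltaParam Ω α) (deltaParam Ω α)))).mul_const (a ⬝ᵥ deltaParam Ω α)
  have h2 := (memLp_dotProduct_gaussPi hR a).comp_snd halfNormal
  refine ((memLp_const (a ⬝ᵥ m)).add (h1.add h2)).congr_norm ?_ (ae_of_all _ fun x => ?_)
  · exact ((measurable_dotProduct_left a).comp (by fun_prop)).aestronglyMeasurable
  · simp [dotProduct_add]

lemma integrable_strongDual_skewPi {Ω : Matrix ι ι ℝ} (hΩ : Ω.PosDef) (m α : ι → ℝ)
    (l : StrongDual ℝ (ι → ℝ)) : Integrable l (skewPi m Ω α) := by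
  have : IsFiniteMeasure (skewPi m Ω α) := by rw [skewPi_eq_map hΩ]; infer_instance
  obtain ⟨a, ha⟩ := exists_eq_dotProduct l
  have := (memLp_dotProduct_skewPi hΩ m α a).integrable (by norm_num)
  rwa [← funext ha] at this

lemma integral_dotProduct_skewPi {Ω : Matrix ι ι ℝ} (hΩ : Ω.PosDef) (α a : ι → ℝ) :
    ∫ x, a ⬝ᵥ x ∂skewPi 0 Ω α = (∫ s, s ∂halfNormal) * (a ⬝ᵥ deltaParam Ω α) := by
  have ha := measurable_dotProduct_left a
  have hR := posSemidef_sub_vecMulVec_deltaParam hΩ α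
  rw [skewPi_eq_map hΩ, integral_map (by fun_prop) ha.aestronglyMeasurable]
  simp only [zero_add, dotProduct_add, dotProduct_smul, smul_eq_mul]
  rw [integral_add (((memLp_id_halfNormal.integrable (by norm_num)).comp_fst _).mul_const _)
    (((memLp_dotProduct_gaussPi hR a).integrable (by norm_num)).comp_snd _), integral_mul_const,
    integral_fun_fst (fun s : ℝ => s), integral_fun_snd (fun x => a ⬝ᵥ x),
    integral_dotProduct_gaussPi hR]
  simp

/-- The mixed term vanishes because `R` is centred and independent of `|U|`. Once `δ` is fixed, `Ω`
enters only through `aᵀ Ω a`. -/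
lemma integral_dotProduct_sq_skewPi {Ω : Matrix ι ι ℝ} (hΩ : Ω.PosDef) (α a : ι → ℝ) :
    ∫ x, (a ⬝ᵥ x) ^ 2 ∂skewPi 0 Ω α = (∫ s, s ^ 2 ∂halfNormal) * (a ⬝ᵥ deltaParam Ω α) ^ 2 +
      halfNormal.real Set.univ * (a ⬝ᵥ (Ω *ᵥ a) - (a ⬝ᵥ deltaParam Ω α) ^ 2) := by
  have ha := measurable_dotProduct_left a
  have hR := posSemidef_sub_vecMulVec_deltaParam hΩ α
  rw [skewPi_eq_map hΩ, integral_map (by fun_prop) (by fun_prop)]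
  set d := a ⬝ᵥ deltaParam Ω α with hd
  set R := Ω - Matrix.vecMulVec (deltaParam Ω α) (deltaParam Ω α) with hRdef
  have hexp (x : ℝ × (ι → ℝ)) : (a ⬝ᵥ (0 + (x.1 • deltaParam Ω α + x.2))) ^ 2 =
      x.1 ^ 2 * d ^ 2 + (2 * d) * (x.1 * (a ⬝ᵥ x.2)) + (a ⬝ᵥ x.2) ^ 2 := by
    rw [zero_add, dotProduct_add, dotProduct_smul, smul_eq_mul, ← hd]
    ring
  have i1 : Integrable (fun x : ℝ × (ι → ℝ) => x.1 ^ 2 * d ^ 2) (halfNormal.prod (gaussPi R)) :=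
    (memLp_id_halfNormal.integrable_sq.comp_fst _).mul_const _
  have i2 : Integrable (fun x : ℝ × (ι → ℝ) => (2 * d) * (x.1 * (a ⬝ᵥ x.2)))
      (halfNormal.prod (gaussPi R)) :=
    ((memLp_id_halfNormal.integrable (by norm_num)).mul_prod
      ((memLp_dotProduct_gaussPi hR a).integrable (by norm_num))).const_mul _
  have i3 : Integrable (fun x : ℝ × (ι → ℝ) => (a ⬝ᵥ x.2) ^ 2) (halfNormal.prod (gaussPi R)) :=
    (memLp_dotProduct_gaussPi hR a).integrable_sq.comp_snd _
  have hRa : a ⬝ᵥ (R *ᵥ a) = a ⬝ᵥ (Ω *ᵥ a) - d ^ 2 := by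
    rw [hRdef, Matrix.sub_mulVec, dotProduct_sub, Matrix.vecMulVec_mulVec, op_smul_eq_smul,
      dotProduct_smul, smul_eq_mul, dotProduct_comm (deltaParam Ω α) a]
    ring
  simp_rw [hexp]
  rw [integral_add (f := fun x => x.1 ^ 2 * d ^ 2 + 2 * d * (x.1 * a ⬝ᵥ x.2)) (i1.add i2) i3,
    integral_add i1 i2, integral_mul_const, integral_const_mul,
    integral_prod_mul (fun s : ℝ => s) (fun x => a ⬝ᵥ x), integral_fun_fst (fun s : ℝ => s ^ 2),
    integral_fun_snd (fun x => (a ⬝ᵥ x) ^ 2), integral_dotProduct_gaussPi hR,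
    integral_dotProduct_sq_gaussPi hR, hRa]
  simp

/-- Increasing the scale matrix with `δ` fixed amounts to adding independent Gaussian noise. -/
lemma skewPi_eq_map_add {Ω Ω' : Matrix ι ι ℝ} (hΩ : Ω.PosDef) (hΩ' : Ω'.PosDef) (m α α' : ι → ℝ)
    (hδ : deltaParam Ω α = deltaParam Ω' α') (hD : (Ω' - Ω).PosSemidef) :
    skewPi m Ω' α' = ((skewPi m Ω α).prod (gaussPi (Ω' - Ω))).map fun x => x.1 + x.2 := by
  have hR := posSemidef_sub_vecMulVec_deltaParam hΩ α
  have hsum : gaussPi (Ω' - Matrix.vecMulVec (deltaParam Ω α) (deltaParam Ω α)) =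
      ((gaussPi (Ω - Matrix.vecMulVec (deltaParam Ω α) (deltaParam Ω α))).prod
        (gaussPi (Ω' - Ω))).map fun x => x.1 + x.2 := by
    rw [map_add_gaussPi hR hD]
    congr 1
    abel
  rw [skewPi_eq_map hΩ', skewPi_eq_map hΩ, ← hδ, hsum]
  refine Measure.ext_of_lintegral _ fun h hh => ?_
  rw [lintegral_map hh (by fun_prop), lintegral_map hh (by fun_prop),
    lintegral_prod _ (by fun_prop), lintegral_prod _ (by fun_prop),
    lintegral_map (by fun_prop) (by fun_prop), lintegral_prod _ (by fun_prop)]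
  refine lintegral_congr fun s => ?_
  rw [lintegral_map (by fun_prop) (by fun_prop), lintegral_prod _ (by fun_prop)]
  simp only [add_assoc]

end Moments

/-! ### Transfer between matrices and vectors. -/

section Vectorization

variable {n p : ℕ}

/-- Vectorization as a linear equivalence. -/
def vecEquiv (n p : ℕ) : Matrix (Fin n) (Fin p) ℝ ≃ₗ[ℝ] (Fin p × Fin n → ℝ) where
  toFun := Matrix.vec
  map_add' := Matrix.vec_add
  map_smul' := Matrix.vec_smul
  invFun x := Matrix.of fun i j => x (j, i)
  left_inv _ := rfl
  right_inv _ := rfl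

lemma measurable_vec : Measurable (Matrix.vec : Matrix (Fin n) (Fin p) ℝ → _) :=
  measurable_pi_iff.2 fun ij =>
    (measurable_pi_apply ij.1).comp (measurable_pi_apply (X := fun _ => Fin p → ℝ) ij.2)

lemma measurable_vecEquiv_symm : Measurable (vecEquiv n p).symm :=
  measurable_pi_iff.2 fun i => measurable_pi_iff.2 fun j => measurable_pi_apply (j, i)

lemma measurePreserving_vec :
    MeasurePreserving (Matrix.vec : Matrix (Fin n) (Fin p) ℝ → _) volume volume := by
  refine ⟨measurable_vec, (Measure.pi_eq fun s hs => ?_).symm⟩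
  rw [Measure.map_apply measurable_vec (MeasurableSet.univ_pi hs)]
  have h : (Matrix.vec : Matrix (Fin n) (Fin p) ℝ → _) ⁻¹' (Set.univ.pi s) =
      Set.univ.pi fun i => Set.univ.pi fun j => s (j, i) := by
    ext x
    simp only [Set.mem_preimage, Set.mem_univ_pi, Prod.forall]
    exact ⟨fun h i _ j _ => h j i, fun h j i => h i trivial j trivial⟩
  rw [h]
  change (Measure.pi fun _ : Fin n => (volume : Measure (Fin p → ℝ))) _ = _
  rw [Measure.pi_pi]
  simp_rw [volume_pi_pi]
  rw [Fintype.prod_prod_type, Finset.prod_comm]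

lemma map_vec_law (M B : Matrix (Fin n) (Fin p) ℝ)
    (Ω : Matrix (Fin p × Fin n) (Fin p × Fin n) ℝ) :
    (law M Ω B).map Matrix.vec = skewPi M.vec Ω B.vec := by
  ext s hs
  rw [Measure.map_apply measurable_vec hs, law, withDensity_apply _ (measurable_vec hs), skewPi,
    withDensity_apply _ hs, ← measurePreserving_vec.map_eq,
    setLIntegral_map hs (measurable_skewPi_density _ _ _) measurable_vec]
  simp only [density, Matrix.vec_sub]

lemma hasLaw_vec {S : Type*} [MeasurableSpace S] {P : Measure S}
    {X : S → Matrix (Fin n) (Fin p) ℝ} {M B : Matrix (Fin n) (Fin p) ℝ}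
    {Ω : Matrix (Fin p × Fin n) (Fin p × Fin n) ℝ} (hX : HasLaw X (law M Ω B) P) :
    HasLaw (fun s => (X s).vec) (skewPi M.vec Ω B.vec) P where
  aemeasurable := measurable_vec.comp_aemeasurable hX.aemeasurable
  map_eq := by
    rw [← map_vec_law, ← hX.map_eq,
      AEMeasurable.map_map_of_aemeasurable measurable_vec.aemeasurable hX.aemeasurable]
    rfl

/-- Vectorization is a linear bijection, measurable in both directions, so composing with it or its
inverse preserves the class of test functions. -/
lemma convexOrder_iff_vec {S S' : Type*} [MeasurableSpace S] [MeasurableSpace S'] {P : Measure S}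
    {P' : Measure S'} {X : S → Matrix (Fin n) (Fin p) ℝ} {Y : S' → Matrix (Fin n) (Fin p) ℝ} :
    ConvexOrder P X P' Y ↔
      IntegralOrder {g : (Fin p × Fin n → ℝ) → ℝ | Measurable g ∧ ConvexOn ℝ Set.univ g}
        P (fun s => (X s).vec) P' (fun s => (Y s).vec) := by
  constructor
  · rintro h g ⟨hgm, hgc⟩
    exact h (fun Z => g Z.vec)
      ⟨hgm.comp measurable_vec, hgc.comp_linearMap (vecEquiv n p).toLinearMap⟩
  · rintro h f ⟨hfm, hfc⟩
    exact h (fun x => f ((vecEquiv n p).symm x))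
      ⟨hfm.comp measurable_vecEquiv_symm, hfc.comp_linearMap (vecEquiv n p).symm.toLinearMap⟩

end Vectorization

/-! ### The convex order of skew-normal vectors. -/

section VectorOrder

lemma integral_le_of_integralOrder {S S' E : Type*} [MeasurableSpace S] [MeasurableSpace S']
    [MeasurableSpace E] {P : Measure S} {P' : Measure S'} {X : S → E} {Y : S' → E}
    {F : Set (E → ℝ)} {μ ν : Measure E}
    (hX : HasLaw X μ P) (hY : HasLaw Y ν P') (h : IntegralOrder F P X P' Y) {g : E → ℝ}
    (hg : g ∈ F) (hm : Measurable g) (hμ : Integrable g μ) (hν : Integrable g ν) :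
    ∫ x, g x ∂μ ≤ ∫ x, g x ∂ν := by
  have iX : Integrable (fun s => g (X s)) P := by
    rw [← hX.map_eq] at hμ
    exact hμ.comp_aemeasurable hX.aemeasurable
  have iY : Integrable (fun s => g (Y s)) P' := by
    rw [← hY.map_eq] at hν
    exact hν.comp_aemeasurable hY.aemeasurable
  have hle := h g hg (expectationWellDefined_of_integrable iX)
    (expectationWellDefined_of_integrable iY)
  rwa [extExpectation_comp_of_hasLaw hX hm, extExpectation_comp_of_hasLaw hY hm,
    extExpectation_eq_integral hμ, extExpectation_eq_integral hν, EReal.coe_le_coe_iff] at hle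
variable {ι : Type*} [Fintype ι] [DecidableEq ι] {S S' : Type*} [MeasurableSpace S]
  [MeasurableSpace S'] {P : Measure S} {P' : Measure S'} {X : S → ι → ℝ} {Y : S' → ι → ℝ}
  {Ω Ω' : Matrix ι ι ℝ} {m α α' : ι → ℝ}

theorem integralOrder_convex_of_posSemidef (hΩ : Ω.PosDef) (hΩ' : Ω'.PosDef)
    (hX : HasLaw X (skewPi m Ω α) P) (hY : HasLaw Y (skewPi m Ω' α') P')
    (hδ : deltaParam Ω α = deltaParam Ω' α') (hD : (Ω' - Ω).PosSemidef) :
    IntegralOrder {g : (ι → ℝ) → ℝ | Measurable g ∧ ConvexOn ℝ Set.univ g} P X P' Y := by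
  rintro g ⟨hgm, hgc⟩ - -
  have : IsFiniteMeasure (skewPi m Ω α) := by rw [skewPi_eq_map hΩ]; infer_instance
  rw [extExpectation_comp_of_hasLaw hX hgm, extExpectation_comp_of_hasLaw hY hgm]
  exact extExpectation_le_of_symmetric_noise hgc (map_neg_gaussPi hD)
    (skewPi_eq_map_add hΩ hΩ' m α α' hδ hD) (integrable_strongDual_skewPi hΩ m α)
    (integrable_strongDual_skewPi hΩ' m α')

lemma convexOn_dotProduct {ι : Type*} [Fintype ι] (a : ι → ℝ) :
    ConvexOn ℝ Set.univ fun x : ι → ℝ => a ⬝ᵥ x := by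
  refine ⟨convex_univ, fun x _ y _ s t _ _ _ => ?_⟩
  simp [dotProduct_add]

lemma convexOn_dotProduct_sq {ι : Type*} [Fintype ι] (a : ι → ℝ) :
    ConvexOn ℝ Set.univ fun x : ι → ℝ => (a ⬝ᵥ x) ^ 2 := by
  refine ⟨convex_univ, fun x _ y _ s t hs ht hst => ?_⟩
  have h := (even_two.convexOn_pow (𝕜 := ℝ)).2 (Set.mem_univ (a ⬝ᵥ x)) (Set.mem_univ (a ⬝ᵥ y))
    hs ht hst
  simpa [dotProduct_add] using h

theorem delta_eq_and_posSemidef_of_integralOrder (hΩ : Ω.PosDef) (hΩ' : Ω'.PosDef)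
    (hX : HasLaw X (skewPi 0 Ω α) P) (hY : HasLaw Y (skewPi 0 Ω' α') P')
    (h : IntegralOrder {g : (ι → ℝ) → ℝ | Measurable g ∧ ConvexOn ℝ Set.univ g} P X P' Y) :
    deltaParam Ω α = deltaParam Ω' α' ∧ (Ω' - Ω).PosSemidef := by
  have : IsFiniteMeasure (skewPi 0 Ω α) := by rw [skewPi_eq_map hΩ]; infer_instance
  have : IsFiniteMeasure (skewPi 0 Ω' α') := by rw [skewPi_eq_map hΩ']; infer_instance
  have hlin (a : ι → ℝ) : a ⬝ᵥ deltaParam Ω α ≤ a ⬝ᵥ deltaParam Ω' α' := by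
    have hle := integral_le_of_integralOrder hX hY h
      ⟨measurable_dotProduct_left a, convexOn_dotProduct a⟩ (measurable_dotProduct_left a)
      ((memLp_dotProduct_skewPi hΩ 0 α a).integrable (by norm_num))
      ((memLp_dotProduct_skewPi hΩ' 0 α' a).integrable (by norm_num))
    rw [integral_dotProduct_skewPi hΩ, integral_dotProduct_skewPi hΩ'] at hle
    exact le_of_mul_le_mul_left hle integral_halfNormal_pos
  have hδ : deltaParam Ω α = deltaParam Ω' α' := by
    refine dotProduct_eq _ _ fun a => ?_
    rw [dotProduct_comm _ a, dotProduct_comm _ a]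
    -- Both `a` and `-a` give convex test functions, which turns the inequality into an equality.
    have := hlin (-a)
    simp only [neg_dotProduct] at this
    exact le_antisymm (hlin a) (by linarith)
  refine ⟨hδ, Matrix.PosSemidef.of_dotProduct_mulVec_nonneg
    (hΩ'.isHermitian.sub hΩ.isHermitian) fun a => ?_⟩
  have hm : Measurable fun x : ι → ℝ => (a ⬝ᵥ x) ^ 2 := (measurable_dotProduct_left a).pow_const 2
  have hle := integral_le_of_integralOrder hX hY h ⟨hm, convexOn_dotProduct_sq a⟩ hm
    (memLp_dotProduct_skewPi hΩ 0 α a).integrable_sq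
    (memLp_dotProduct_skewPi hΩ' 0 α' a).integrable_sq
  rw [integral_dotProduct_sq_skewPi hΩ, integral_dotProduct_sq_skewPi hΩ', ← hδ] at hle
  -- Since the `δ` vectors agree, the second-moment term of `|U|` is common to both sides and drops
  -- out, leaving the comparison of the covariances of `R`.
  have := le_of_mul_le_mul_left (le_of_add_le_add_left hle) halfNormal_real_univ_pos
  have hstar : star a = a := by ext i; simp
  rw [hstar, Matrix.sub_mulVec, dotProduct_sub]
  linarith

/-- Congruence by the invertible symmetric matrix `ω⁻¹`; it lets the vector results be applied with
the correlation matrix itself as scale. -/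
lemma posDef_corr (hΩ : Ω.PosDef) : (corr Ω).PosDef := by
  have hU : IsUnit (scaleDiag Ω)⁻¹ :=
    (Matrix.isUnit_nonsing_inv_iff).2 ((Matrix.isUnit_iff_isUnit_det _).2 (isUnit_det_scaleDiag hΩ))
  have h := hΩ.conjTranspose_mul_mul_same (Matrix.mulVec_injective_of_isUnit hU)
  rwa [Matrix.conjTranspose_eq_transpose_of_trivial, scaleDiag_inv_transpose] at h

end VectorOrder

end MatrixSkewNormal

theorem mainTheorem4 {n p : ℕ}
    (V V' : Matrix (Fin p) (Fin p) ℝ) (Sig Sig' : Matrix (Fin n) (Fin n) ℝ)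
    (hV : V.PosDef) (hV' : V'.PosDef) (hSig : Sig.PosDef) (hSig' : Sig'.PosDef)
    {S S' : Type*} [MeasurableSpace S] [MeasurableSpace S']
    (P : Measure S) [IsProbabilityMeasure P] (P' : Measure S') [IsProbabilityMeasure P'] :
    (∀ (M M' B B' : Matrix (Fin n) (Fin p) ℝ) (δ δ' : Fin p × Fin n → ℝ)
        (X : S → Matrix (Fin n) (Fin p) ℝ) (Y : S' → Matrix (Fin n) (Fin p) ℝ),
        MatrixSkewNormal.IsSkewNormal P X M (V ⊗ₖ Sig) B δ →
        MatrixSkewNormal.IsSkewNormal P' Y M' (V' ⊗ₖ Sig') B' δ' →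
        M = M' → δ = δ' → (V' ⊗ₖ Sig' - V ⊗ₖ Sig).PosSemidef →
        MatrixSkewNormal.ConvexOrder P X P' Y) ∧
    (∀ (B B' : Matrix (Fin n) (Fin p) ℝ) (δ δ' : Fin p × Fin n → ℝ)
        (X₀ : S → Matrix (Fin n) (Fin p) ℝ) (Y₀ : S' → Matrix (Fin n) (Fin p) ℝ),
        MatrixSkewNormal.IsSkewNormal P X₀ 0 (MatrixSkewNormal.corr (V ⊗ₖ Sig)) B δ →
        MatrixSkewNormal.IsSkewNormal P' Y₀ 0 (MatrixSkewNormal.corr (V' ⊗ₖ Sig')) B' δ' →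
        (MatrixSkewNormal.ConvexOrder P X₀ P' Y₀ ↔
          δ = δ' ∧ (MatrixSkewNormal.corr (V' ⊗ₖ Sig') -
            MatrixSkewNormal.corr (V ⊗ₖ Sig)).PosSemidef)) := by
  open MatrixSkewNormal in
  have hΩ : (V ⊗ₖ Sig).PosDef := hV.kronecker hSig
  have hΩ' : (V' ⊗ₖ Sig').PosDef := hV'.kronecker hSig'
  refine ⟨?_, ?_⟩
  · rintro M M' B B' δ δ' X Y hX hY rfl hδ hD
    rw [hX.delta_eq, hY.delta_eq] at hδ
    exact convexOrder_iff_vec.2 (integralOrder_convex_of_posSemidef hΩ hΩ' (hasLaw_vec hX.hasLaw)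
      (hasLaw_vec hY.hasLaw) hδ hD)
  · intro B B' δ δ' X₀ Y₀ hX hY
    have hlX := hasLaw_vec hX.hasLaw
    have hlY := hasLaw_vec hY.hasLaw
    rw [Matrix.vec_zero] at hlX hlY
    rw [convexOrder_iff_vec, hX.delta_eq, hY.delta_eq]
    exact ⟨delta_eq_and_posSemidef_of_integralOrder (posDef_corr hΩ) (posDef_corr hΩ') hlX hlY,
      fun h => integralOrder_convex_of_posSemidef (posDef_corr hΩ) (posDef_corr hΩ') hlX hlY
        h.1 h.2⟩
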